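/- Let $d \ge 1$ and $\boldsymbol\beta = (\beta_1,\dots,\beta_d)$ with all $\beta_j > 0$, and define $\beta$ by $\frac1\beta = \frac1d\sum_{j=1}^d \frac1{\beta_j}$. Let $C^{\boldsymbol\beta}$ be the space of functions $f:\mathbb R^d\to\mathbb R$ which, for every $i$, admit partial derivatives $\partial^{k} f/\partial x_i^{k}$ of all orders $k \le \lfloor\beta_i\rfloor$ and have finite semi-norms $$|f|_{i,\beta_i} = \sup_{x\in\mathbb R^d}\ \sup_{t \neq 0}\ \frac{1}{|t|^{\beta_i-\lfloor\beta_i\rfloor}}\left|\frac{\partial^{\lfloor\beta_i\rfloor} f}{\partial x_i^{\lfloor\beta_i\rfloor}}(x+te_i) - \frac{\partial^{\lfloor\beta_i\rfloor} f}{\partial x_i^{\lfloor\beta_i\rfloor}}(x)\right| .$$ For $\mathbf L = (L_1,\dots,L_d)\in[0,\infty)^d$ and $b\in(0,\infty]$ let $$\mathcal C^{\boldsymbol\beta}_{\mathbf L,b} = \{f\in C^{\boldsymbol\beta} : \|f\|_\infty\le b,\ |f|_{j,\beta_j}\le L_j \text{ for all } j\},$$ where $\|\cdot\|_\infty$ is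 the essential supremum norm with respect to Lebesgue measure, and let $\mathcal P^{\boldsymbol\beta}_{\mathbf L,b}$ be the set of probability density functions in $\mathcal C^{\boldsymbol\beta}_{\mathbf L,b}$. For $b \in (0,\infty)$ let $p_b$ be the isotropic centered Gaussian density on $\mathbb R^d$ with $\|p_b\|_\infty = b$. **Theorem.** There is a constant $C>0$, depending only on $\boldsymbol\beta$ and $d$, such that for all $\mathbf L\in[0,\infty)^d$ and all $b \in (0,\infty)$ with $p_b\in\mathcal C^{\boldsymbol\beta}_{\mathbf L/2,+\infty}$ there is an $N$ such that for all $n\ge N$ $$\inf_{\tilde p}\ \sup_{p\in\mathcal P^{\boldsymbol\beta}_{\mathbf L,b}} \mathbb E_p\bigl[\|\tilde p-p\|_\infty\bigr] \ \ge\ C\, b^{\frac{\beta}{2\beta+d}}\left(\prod_{j=1}^d L_j^{\frac{\beta}{\beta_j}}\right)^{\frac1{2\beta+d}}\left(\frac{\log n}{n}\right)^{\frac{\beta}{2\beta+d}},$$ where the infimum runs over all estimators $\tilde p$ computed from an i.i.d. sample of size $n$ drawn from $p$. -/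

import Mathlib

open MeasureTheory ProbabilityTheory
open scoped ENNReal NNReal

namespace AnisoDensity

/-- The `k`-th order partial derivative of `f : ℝ^d → ℝ` in the `i`-th coordinate direction,
obtained by differentiating `k` times along the `i`-th basis vector. -/
noncomputable def iterPartial {d : ℕ} (i : Fin d) (k : ℕ) (f : (Fin d → ℝ) → ℝ) :
    (Fin d → ℝ) → ℝ :=
  (fun g x => lineDeriv ℝ g x (Pi.single i 1))^[k] f

/-- `f` admits partial derivatives of all orders `k ≤ m` in the `i`-th coordinate direction,
at every point: for `k < m` the `k`-th partial derivative is differentiable along the `i`-th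
basis vector. -/
def HasIterPartials {d : ℕ} (i : Fin d) (m : ℕ) (f : (Fin d → ℝ) → ℝ) : Prop :=
  ∀ k < m, ∀ x, LineDifferentiableAt ℝ (iterPartial i k f) x (Pi.single i 1)

/-- The Hölder semi-norm of order `s` in the `i`-th coordinate direction, with values in
`[0, ∞]`: the supremum over `x` and `t` of
`|∂_i^⌊s⌋ f (x + t e_i) - ∂_i^⌊s⌋ f x| / |t| ^ (s - ⌊s⌋)`. The value `t = 0` contributes `0`. -/
noncomputable def holderSeminorm {d : ℕ} (i : Fin d) (s : ℝ) (f : (Fin d → ℝ) → ℝ) : ℝ≥0∞ :=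
  ⨆ (x : Fin d → ℝ) (t : ℝ),
    ENNReal.ofReal (|iterPartial i ⌊s⌋₊ f (x + t • Pi.single i 1) - iterPartial i ⌊s⌋₊ f x|
      / |t| ^ (s - ⌊s⌋₊))

/-- The anisotropic space `C^β`. -/
def anisoSpace {d : ℕ} (β : Fin d → ℝ) : Set ((Fin d → ℝ) → ℝ) :=
  {f | ∀ i, HasIterPartials i ⌊β i⌋₊ f ∧ holderSeminorm i (β i) f < ∞}

/-- The class `C^β_{L,b}`: essential supremum of `|f|` at most `b` (where `b = ∞` is allowed), and
`i`-th Hölder semi-norm at most `L i` for every `i`. -/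
def anisoClass {d : ℕ} (β L : Fin d → ℝ) (b : ℝ≥0∞) : Set ((Fin d → ℝ) → ℝ) :=
  {f | f ∈ anisoSpace β ∧ eLpNormEssSup f volume ≤ b ∧
    ∀ i, holderSeminorm i (β i) f ≤ ENNReal.ofReal (L i)}

/-- Probability density functions on `ℝ^d` with respect to Lebesgue measure. -/
structure IsProbDensity {d : ℕ} (p : (Fin d → ℝ) → ℝ) : Prop where
  measurable : Measurable p
  nonneg : ∀ x, 0 ≤ p x
  lintegral_eq_one : ∫⁻ x, ENNReal.ofReal (p x) = 1

/-- The class `P^β_{L,b}` of probability densities in `C^β_{L,b}`. -/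
def densityClass {d : ℕ} (β L : Fin d → ℝ) (b : ℝ≥0∞) : Set ((Fin d → ℝ) → ℝ) :=
  {p | IsProbDensity p ∧ p ∈ anisoClass β L b}

/-- The law of an i.i.d. sample of size `n` drawn from the density `p`. -/
noncomputable def sampleLaw {d : ℕ} (n : ℕ) (p : (Fin d → ℝ) → ℝ) :
    Measure (Fin n → Fin d → ℝ) :=
  Measure.pi fun _ => (volume : Measure (Fin d → ℝ)).withDensity fun x => ENNReal.ofReal (p x)

/-- An estimator over the class `P` computed from a sample of size `n`: a map which sends each
sample to a Borel function on `ℝ^d`, and whose sup-norm loss is a random variable (so that its risk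
makes sense) at every `p ∈ P`. -/
structure IsEstimator {d n : ℕ} (P : Set ((Fin d → ℝ) → ℝ))
    (est : (Fin n → Fin d → ℝ) → (Fin d → ℝ) → ℝ) : Prop where
  measurable_value : ∀ x, Measurable (est x)
  measurable_loss : ∀ p ∈ P, Measurable fun x => eLpNormEssSup (est x - p) volume

/-- Jointly measurable maps are estimators over every class of measurable functions. -/
theorem IsEstimator.of_measurable_uncurry {d n : ℕ} {P : Set ((Fin d → ℝ) → ℝ)}
    (hP : ∀ p ∈ P, Measurable p) {est : (Fin n → Fin d → ℝ) → (Fin d → ℝ) → ℝ}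
    (h : Measurable (Function.uncurry est)) : IsEstimator P est := by
  refine ⟨fun x => h.comp measurable_prodMk_left, fun p hp => ?_⟩
  refine measurable_of_Iic fun c => ?_
  have hs : MeasurableSet {z : (Fin n → Fin d → ℝ) × (Fin d → ℝ) |
      c < ‖est z.1 z.2 - p z.2‖ₑ} :=
    measurableSet_lt measurable_const (h.sub ((hP p hp).comp measurable_snd)).enorm
  have hm := measurable_measure_prodMk_left (ν := (volume : Measure (Fin d → ℝ))) hs
  convert hm (measurableSet_singleton (0 : ℝ≥0∞)) using 1
  ext x
  simp only [Set.mem_preimage, Set.mem_Iic, Set.mem_singleton_iff]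
  constructor
  · intro hx
    have := ae_le_eLpNormEssSup (f := est x - p) (μ := (volume : Measure (Fin d → ℝ)))
    have h2 : ∀ᵐ y, ‖est x y - p y‖ₑ ≤ c := this.mono fun y hy => hy.trans hx
    simpa [ae_iff] using h2
  · intro hx
    refine essSup_le_of_ae_le c ?_
    have : ∀ᵐ y, ‖est x y - p y‖ₑ ≤ c := by simpa [ae_iff] using hx
    exact this

/-- The minimax sup-norm risk over `P` for samples of size `n`, with values in `[0, ∞]`. -/
noncomputable def minimaxRisk {d : ℕ} (n : ℕ) (P : Set ((Fin d → ℝ) → ℝ)) : ℝ≥0∞ :=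
  ⨅ (est : (Fin n → Fin d → ℝ) → (Fin d → ℝ) → ℝ) (_ : IsEstimator P est),
    ⨆ p ∈ P, ∫⁻ x, eLpNormEssSup (est x - p) volume ∂(sampleLaw n p)

/-- The effective smoothness: `1/β = (1/d) ∑ 1/β_j`. -/
noncomputable def effSmoothness {d : ℕ} (β : Fin d → ℝ) : ℝ :=
  ((1 / d : ℝ) * ∑ j, 1 / β j)⁻¹

/-- The density of the centered isotropic Gaussian law on `ℝ^d` with variance
`b ^ (-2/d) / (2π)` in each coordinate, which is the one with maximum `b`. -/
noncomputable def gaussianOfSup (d : ℕ) (b : ℝ) (x : Fin d → ℝ) : ℝ :=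
  ∏ i, gaussianPDFReal 0 (Real.toNNReal (b ^ (-(2 : ℝ) / d) / (2 * Real.pi))) (x i)

theorem gaussianOfSup_eq {d : ℕ} (hd : 0 < d) {b : ℝ} (hb : 0 < b) (x : Fin d → ℝ) :
    gaussianOfSup d b x = b * Real.exp (-(Real.pi * b ^ ((2 : ℝ) / d) * ∑ i, x i ^ 2)) := by
  have hd' : (d : ℝ) ≠ 0 := by positivity
  have hv : 0 ≤ b ^ (-(2 : ℝ) / d) / (2 * Real.pi) := by positivity
  have e1 : 2 * Real.pi * (b ^ (-(2 : ℝ) / d) / (2 * Real.pi)) = b ^ (-(2 : ℝ) / d) := by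
    field_simp
  have e2 : (√(b ^ (-(2 : ℝ) / d)))⁻¹ = b ^ ((1 : ℝ) / d) := by
    rw [Real.sqrt_eq_rpow, ← Real.rpow_mul hb.le, ← Real.rpow_neg hb.le]
    congr 1
    ring
  have e3 : (b ^ ((1 : ℝ) / d)) ^ d = b := by
    rw [← Real.rpow_natCast, ← Real.rpow_mul hb.le, one_div_mul_cancel hd', Real.rpow_one]
  have e4 : ∀ y : ℝ, -(y - 0) ^ 2 / (2 * (b ^ (-(2 : ℝ) / d) / (2 * Real.pi)))
      = -(Real.pi * b ^ ((2 : ℝ) / d) * y ^ 2) := by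
    intro y
    rw [neg_div (d : ℝ) 2, Real.rpow_neg hb.le]
    have : b ^ ((2 : ℝ) / d) ≠ 0 := by positivity
    field_simp
    ring
  simp only [gaussianOfSup, gaussianPDFReal, Real.coe_toNNReal _ hv, e1, e2, e4]
  rw [Finset.prod_mul_distrib, ← Real.exp_sum, Finset.prod_const, Finset.card_univ,
    Fintype.card_fin, e3, Finset.sum_neg_distrib, ← Finset.mul_sum]

end AnisoDensity

/-! The bound is a Le Cam argument testing the Gaussian `p` against a uniform mixture of `M`
alternatives `p + g k`. The `g k` are translates, along one axis, of a single mean-zero bump with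
height parameter `A` and bandwidths `h j`. Their supports are disjoint and lie in the cube `[r,
2r]^d`, `r = b ^ (-1/d)`, where `p` lies between a fixed multiple of `b` and `b / 2`. Thus small
bumps keep the sum nonnegative and at most `b`.

Disjoint supports make the `n`-sample likelihood ratios satisfy `∫ F k * F l = 1` for `k ≠ l`, while
`∫ F k ^ 2 ≤ (1 + ρ) ^ n` with `ρ = A ^ 2 * ∏ h j / (q * b)` and `q = exp (-4πd)`. If this is at
most `M / 4`, the averaged likelihood ratio has variance at most `1 / 4`, and no test has total
error below `1 / 2` (`half_le_error_of_orthogonal`, `half_le_test_error_of_disjoint`). Markov's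
inequality and the triangle inequality turn this into a risk bound of order `A`
(`le_minimaxRisk_of_test`, `le_minimaxRisk_of_bumps`).

It remains to choose parameters. The Gaussian uses half of each Hölder budget; spending the other
half on the bump gives `h j` proportional to `(A / L j) ^ (1 / β j)`. Taking `A` of order `(b * Λ *
log n / n) ^ γ`, where `Λ = ∏ L j ^ (1 / β j)` and `γ = β / (2β + d)`, makes `ρ` a small multiple of
`log n / n`, so `(1 + ρ) ^ n` is at most a small power of `n`. The number of bumps that fit on the
axis grows like a larger power of `n / log n`; this is the source of the logarithm in the rate. -/

namespace AnisoDensity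

/-! ### Testing a point against a uniform mixture -/

/-- The law of an i.i.d. sample from a measure with a density has the product density. -/
theorem pi_withDensity_ofReal {ι E : Type*} [Fintype ι] [MeasurableSpace E] (μ : Measure E)
    [SigmaFinite μ] {f : E → ℝ} (hf : Integrable f μ) (hf0 : ∀ x, 0 ≤ f x) :
    Measure.pi (fun _ : ι => μ.withDensity fun x => ENNReal.ofReal (f x)) =
      (Measure.pi fun _ : ι => μ).withDensity fun x => ENNReal.ofReal (∏ i, f (x i)) := by
  classical
  have : IsFiniteMeasure (μ.withDensity fun x => ENNReal.ofReal (f x)) :=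
    isFiniteMeasure_withDensity_ofReal hf.2
  refine Measure.pi_eq fun s hs => ?_
  have hind : ∀ i, Integrable ((s i).indicator f) μ := fun i => hf.indicator (hs i)
  have hind0 : ∀ i x, 0 ≤ (s i).indicator f x :=
    fun i x => Set.indicator_nonneg (fun x _ => hf0 x) x
  -- Restricting to a rectangle keeps the integrand a product over coordinates, so Fubini for real
  -- products applies.
  have key : ∀ x : ι → E, (Set.univ.pi s).indicator
      (fun x => ENNReal.ofReal (∏ i, f (x i))) x
        = ENNReal.ofReal (∏ i, (s i).indicator f (x i)) := by
    intro x
    by_cases hx : x ∈ Set.univ.pi s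
    · rw [Set.indicator_of_mem hx]
      congr 1
      exact Finset.prod_congr rfl fun i _ =>
        (Set.indicator_of_mem (hx i (Set.mem_univ i)) f).symm
    · rw [Set.indicator_of_notMem hx]
      obtain ⟨i, hi⟩ : ∃ i, x i ∉ s i := by simpa [Set.mem_pi] using hx
      rw [Finset.prod_eq_zero (Finset.mem_univ i) (Set.indicator_of_notMem hi f),
        ENNReal.ofReal_zero]
  rw [withDensity_apply _ (MeasurableSet.univ_pi hs),
    ← lintegral_indicator (MeasurableSet.univ_pi hs), lintegral_congr key,
    ← ofReal_integral_eq_lintegral_ofReal (Integrable.fintype_prod hind)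
      (Filter.Eventually.of_forall fun x => Finset.prod_nonneg fun i _ => hind0 i _),
    integral_fintype_prod_eq_prod,
    ENNReal.ofReal_prod_of_nonneg fun i _ => integral_nonneg (hind0 i)]
  refine Finset.prod_congr rfl fun i _ => ?_
  rw [withDensity_apply _ (hs i), ← lintegral_indicator (hs i),
    ofReal_integral_eq_lintegral_ofReal (hind i) (Filter.Eventually.of_forall (hind0 i))]
  refine lintegral_congr fun x => ?_
  by_cases hx : x ∈ s i <;> simp [hx]

/-- A probability measure and a uniform mixture of measures with nearly orthogonal likelihood
ratios cannot be separated by a test. -/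
theorem half_le_error_of_orthogonal {Ω : Type*} [MeasurableSpace Ω] (P : Measure Ω)
    [IsProbabilityMeasure P] {M : ℕ} (hM : 0 < M) {F : Fin M → Ω → ℝ}
    (hF : ∀ k, Integrable (F k) P) (hFF : ∀ k l, Integrable (fun x => F k x * F l x) P)
    (hone : ∀ k, ∫ x, F k x ∂P = 1) (horth : ∀ k l, k ≠ l → ∫ x, F k x * F l x ∂P = 1)
    (hsq : ∀ k, ∫ x, F k x * F k x ∂P ≤ M / 4) {E : Set Ω} (hE : MeasurableSet E) :
    1 / 2 ≤ P.real Eᶜ + (M : ℝ)⁻¹ * ∑ k, ∫ x in E, F k x ∂P := by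
  have hM' : (0 : ℝ) < M := by exact_mod_cast hM
  set f : Ω → ℝ := fun x => (M : ℝ)⁻¹ * ∑ k, F k x with hf
  have hfi : Integrable f P := (integrable_finsetSum _ fun k _ => hF k).const_mul _
  have hff : (fun x => f x * f x)
      = fun x => ((M : ℝ)⁻¹ * (M : ℝ)⁻¹) * ∑ k, ∑ l, F k x * F l x := by
    funext x
    simp only [hf]
    rw [← Finset.sum_mul_sum]
    ring
  have hffi : Integrable (fun x => f x * f x) P := by
    rw [hff]
    exact (integrable_finsetSum _ fun k _ => integrable_finsetSum _ fun l _ => hFF k l).const_mul _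
  have h1 : ∫ x, f x ∂P = 1 := by
    simp only [hf]
    rw [integral_const_mul, integral_finsetSum _ fun k _ => hF k]
    simp only [hone, Finset.sum_const, Finset.card_univ, Fintype.card_fin, nsmul_eq_mul, mul_one]
    field_simp
  have h2 : ∫ x, f x * f x ∂P ≤ 5 / 4 := by
    rw [hff, integral_const_mul, integral_finsetSum _
      fun k _ => integrable_finsetSum _ fun l _ => hFF k l]
    -- Each row of the Gram matrix has diagonal at most `M / 4` and off-diagonal entries `1`, hence
    -- sum at most `5M / 4`.
    have hrow : ∀ k : Fin M, ∫ x, ∑ l, F k x * F l x ∂P ≤ M * (5 / 4) := by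
      intro k
      rw [integral_finsetSum _ fun l _ => hFF k l, ← Finset.add_sum_erase _ _ (Finset.mem_univ k)]
      have : ∑ l ∈ Finset.univ.erase k, ∫ x, F k x * F l x ∂P
          ≤ ∑ l ∈ (Finset.univ : Finset (Fin M)).erase k, (1 : ℝ) :=
        Finset.sum_le_sum fun l hl => (horth k l (Finset.ne_of_mem_erase hl).symm).le
      have h3 : ∑ l ∈ (Finset.univ : Finset (Fin M)).erase k, (1 : ℝ) ≤ M := by
        rw [Finset.sum_const, nsmul_eq_mul, mul_one]
        exact_mod_cast (Finset.card_le_univ _).trans (by simp)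
      linarith [hsq k]
    have hsum := Finset.sum_le_sum fun k (_ : k ∈ Finset.univ) => hrow k
    rw [Finset.sum_const, Finset.card_univ, Fintype.card_fin, nsmul_eq_mul] at hsum
    calc _ ≤ ((M : ℝ)⁻¹ * (M : ℝ)⁻¹) * (M * (M * (5 / 4))) := by gcongr
      _ = 5 / 4 := by field_simp
  have hlin : Integrable (fun x => 1 - 2 * f x) P := (integrable_const 1).sub (hfi.const_mul 2)
  have hdev : Integrable (fun x => (1 - f x) ^ 2) P := by
    have : (fun x => (1 - f x) ^ 2) = fun x => 1 - 2 * f x + f x * f x := by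
      funext x; ring
    rw [this]
    exact hlin.add hffi
  have h3 : ∫ x, (1 - f x) ^ 2 ∂P ≤ 1 / 4 := by
    have : (fun x => (1 - f x) ^ 2) = fun x => 1 - 2 * f x + f x * f x := by
      funext x; ring
    rw [this, integral_add hlin hffi,
      integral_sub (integrable_const 1) (hfi.const_mul 2), integral_const_mul, h1]
    simp only [integral_const, probReal_univ, smul_eq_mul]
    linarith
  have h4 : ∫ x in E, (1 - f x) ^ 2 ∂P ≤ 1 / 4 :=
    (setIntegral_le_integral hdev (Filter.Eventually.of_forall fun x => sq_nonneg _)).trans h3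
  -- Pointwise this is `(1 - f - 1/2) ^ 2 ≥ 0`. It yields `∫_E f ≥ (3/4) P(E) - 1/4`, so the total
  -- error is at least `3/4 - P(E)/4 ≥ 1/2`.
  have h5 : ∫ x in E, (3 / 4 - (1 - f x) ^ 2) ∂P ≤ ∫ x in E, f x ∂P := by
    refine integral_mono ((integrable_const _).sub hdev.integrableOn) hfi.integrableOn fun x => ?_
    nlinarith [sq_nonneg (1 - f x - 1 / 2)]
  rw [integral_sub (integrable_const _) hdev.integrableOn] at h5
  simp only [integral_const, measureReal_restrict_apply_univ, smul_eq_mul] at h5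
  have h6 : ∫ x in E, f x ∂P = (M : ℝ)⁻¹ * ∑ k, ∫ x in E, F k x ∂P := by
    simp only [hf]
    rw [integral_const_mul, integral_finsetSum _ fun k _ => (hF k).integrableOn]
  have h7 : P.real Eᶜ = 1 - P.real E := probReal_compl_eq_one_sub hE
  have h8 : P.real E ≤ 1 := measureReal_le_one
  rw [← h6]
  linarith

/-- Reduction of the minimax risk to a test of a point against a uniform mixture. -/
theorem le_minimaxRisk_of_test {d n M : ℕ} (hM : 0 < M) {P : Set ((Fin d → ℝ) → ℝ)}
    {p₀ : (Fin d → ℝ) → ℝ} {p : Fin M → (Fin d → ℝ) → ℝ} (h₀ : p₀ ∈ P) (hp : ∀ k, p k ∈ P)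
    {s : ℝ≥0∞} (hsep : ∀ k, s + s ≤ eLpNormEssSup (p k - p₀) volume)
    (htest : ∀ E, MeasurableSet E →
      2⁻¹ ≤ sampleLaw n p₀ Eᶜ + (M : ℝ≥0∞)⁻¹ * ∑ k, sampleLaw n (p k) E) :
    s * 4⁻¹ ≤ minimaxRisk n P := by
  refine le_iInf₂ fun est hest => ?_
  set R := ⨆ p ∈ P, ∫⁻ x, eLpNormEssSup (est x - p) volume ∂(sampleLaw n p) with hR
  have hle : ∀ q ∈ P, ∫⁻ x, eLpNormEssSup (est x - q) volume ∂(sampleLaw n q) ≤ R :=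
    fun q hq => le_iSup₂_of_le q hq le_rfl
  have hmark : ∀ q ∈ P, s * sampleLaw n q {x | s ≤ eLpNormEssSup (est x - q) volume} ≤ R :=
    fun q hq => (mul_meas_ge_le_lintegral (hest.measurable_loss q hq) s).trans (hle q hq)
  -- The test induced by the estimator: accept `p₀` when the estimate is within `s` of it. On `E`
  -- the estimate is at distance at least `s` from every `p k`, since these are `2s` away from `p₀`.
  set E : Set (Fin n → Fin d → ℝ) := {x | eLpNormEssSup (est x - p₀) volume < s} with hE
  have hEm : MeasurableSet E :=
    measurableSet_lt (hest.measurable_loss p₀ h₀) measurable_const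
  have hEc : Eᶜ = {x | s ≤ eLpNormEssSup (est x - p₀) volume} := by
    ext x; simp [hE]
  have h1 : s * sampleLaw n p₀ Eᶜ ≤ R := hEc ▸ hmark p₀ h₀
  have h2 : ∀ k, s * sampleLaw n (p k) E ≤ R := by
    intro k
    refine le_trans (mul_le_mul_right (measure_mono fun x hx => ?_) s) (hmark (p k) (hp k))
    by_contra hcon
    have hlt : eLpNormEssSup (est x - p k) volume < s := not_le.mp hcon
    have hx' : eLpNormEssSup (est x - p₀) volume < s := hx
    have htri : eLpNormEssSup (p k - p₀) volume
        ≤ eLpNormEssSup (est x - p₀) volume + eLpNormEssSup (est x - p k) volume := by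
      have e : p k - p₀ = (est x - p₀) + (-(est x - p k)) := by abel
      have e2 : eLpNormEssSup (-(est x - p k)) (volume : Measure (Fin d → ℝ))
          = eLpNormEssSup (est x - p k) volume := by
        simp only [eLpNormEssSup, Pi.neg_apply, enorm_neg]
      rw [e, ← e2]
      exact eLpNormEssSup_add_le
    exact absurd ((hsep k).trans htri) (not_le.mpr (ENNReal.add_lt_add hx' hlt))
  have hM0 : (M : ℝ≥0∞) ≠ 0 := by exact_mod_cast hM.ne'
  have h3 : s * 2⁻¹ ≤ R + R :=
    calc s * 2⁻¹ ≤ s * (sampleLaw n p₀ Eᶜ + (M : ℝ≥0∞)⁻¹ * ∑ k, sampleLaw n (p k) E) := by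
          gcongr; exact htest E hEm
      _ = s * sampleLaw n p₀ Eᶜ + (M : ℝ≥0∞)⁻¹ * ∑ k, s * sampleLaw n (p k) E := by
          rw [mul_add, ← Finset.mul_sum]; ring
      _ ≤ R + (M : ℝ≥0∞)⁻¹ * ∑ _k : Fin M, R := by
          gcongr with k _
          exact h2 k
      _ = R + R := by
          rw [Finset.sum_const, Finset.card_univ, Fintype.card_fin, nsmul_eq_mul, ← mul_assoc,
            ENNReal.inv_mul_cancel hM0 (ENNReal.natCast_ne_top M), one_mul]
  have h4 : (4 : ℝ≥0∞)⁻¹ = 2⁻¹ * 2⁻¹ := by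
    rw [← ENNReal.mul_inv (by simp) (by simp)]; norm_num
  calc s * 4⁻¹ = s * 2⁻¹ * 2⁻¹ := by rw [h4, mul_assoc]
    _ ≤ (R + R) * 2⁻¹ := by gcongr
    _ = R := by
        rw [← two_mul, mul_comm 2 R, mul_assoc, ENNReal.mul_inv_cancel (by simp) (by simp), mul_one]

/-! ### Directional derivatives and Hölder semi-norms -/

/-- Iterated partial derivatives are iterated derivatives of the restriction to a line. -/
theorem iterPartial_line {d : ℕ} (i : Fin d) (k : ℕ) (f : (Fin d → ℝ) → ℝ) (x : Fin d → ℝ)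
    (t : ℝ) : iterPartial i k f (x + t • Pi.single i 1)
      = iteratedDeriv k (fun u : ℝ => f (x + u • Pi.single i 1)) t := by
  induction k generalizing t with
  | zero => simp [iterPartial]
  | succ k ih =>
    have h : iterPartial i (k + 1) f
        = fun x => lineDeriv ℝ (iterPartial i k f) x (Pi.single i 1) :=
      Function.iterate_succ_apply' _ _ _
    rw [h, iteratedDeriv_succ]
    simp only [lineDeriv, add_assoc, ← add_smul, ih]
    rw [deriv_comp_const_add, add_zero]

theorem hasIterPartials_of_contDiff {d : ℕ} (i : Fin d) (m : ℕ) {f : (Fin d → ℝ) → ℝ}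
    (hf : ∀ x, ContDiff ℝ m fun u : ℝ => f (x + u • Pi.single i 1)) :
    HasIterPartials i m f := by
  intro k hk x
  unfold LineDifferentiableAt
  simp only [iterPartial_line]
  exact ((hf x).differentiable_iteratedDeriv k (by exact_mod_cast hk)).differentiableAt

theorem HasIterPartials.iterPartial_add {d : ℕ} {i : Fin d} {m : ℕ} {f g : (Fin d → ℝ) → ℝ}
    (hf : HasIterPartials i m f) (hg : HasIterPartials i m g) :
    ∀ k ≤ m, iterPartial i k (f + g) = iterPartial i k f + iterPartial i k g := by
  intro k
  induction k with
  | zero => intro _; rfl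
  | succ k ih =>
    intro hk
    have h : ∀ q : (Fin d → ℝ) → ℝ, iterPartial i (k + 1) q
        = fun x => lineDeriv ℝ (iterPartial i k q) x (Pi.single i 1) :=
      fun q => Function.iterate_succ_apply' _ _ _
    funext x
    rw [h, ih (by omega), Pi.add_apply, h, h]
    exact deriv_add (hf k (by omega) x) (hg k (by omega) x)

theorem HasIterPartials.add {d : ℕ} {i : Fin d} {m : ℕ} {f g : (Fin d → ℝ) → ℝ}
    (hf : HasIterPartials i m f) (hg : HasIterPartials i m g) : HasIterPartials i m (f + g) := by
  intro k hk x
  rw [hf.iterPartial_add hg k hk.le]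
  exact DifferentiableAt.add (hf k hk x) (hg k hk x)

theorem holderSeminorm_add_le {d : ℕ} {i : Fin d} {s : ℝ} {f g : (Fin d → ℝ) → ℝ}
    (hf : HasIterPartials i ⌊s⌋₊ f) (hg : HasIterPartials i ⌊s⌋₊ g) :
    holderSeminorm i s (f + g) ≤ holderSeminorm i s f + holderSeminorm i s g := by
  refine iSup₂_le fun x t => ?_
  rw [hf.iterPartial_add hg _ le_rfl]
  have h : ∀ q : (Fin d → ℝ) → ℝ, ENNReal.ofReal
      (|iterPartial i ⌊s⌋₊ q (x + t • Pi.single i 1) - iterPartial i ⌊s⌋₊ q x|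
        / |t| ^ (s - ⌊s⌋₊)) ≤ holderSeminorm i s q :=
    fun q => le_iSup₂_of_le (f := fun (x : Fin d → ℝ) (t : ℝ) => ENNReal.ofReal
      (|iterPartial i ⌊s⌋₊ q (x + t • Pi.single i 1) - iterPartial i ⌊s⌋₊ q x|
        / |t| ^ (s - ⌊s⌋₊))) x t le_rfl
  refine le_trans ?_ (add_le_add (h f) (h g))
  rw [← ENNReal.ofReal_add (by positivity) (by positivity), ← add_div]
  refine ENNReal.ofReal_le_ofReal ?_
  gcongr
  simp only [Pi.add_apply]
  rw [add_sub_add_comm]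
  exact abs_add_le _ _

/-- Increments of derivatives of a test function are Hölder of every order in `[0, 1]`. -/
theorem exists_iteratedDeriv_holder {φ : ℝ → ℝ} (hφ : ∀ m : ℕ, ContDiff ℝ m φ)
    (hc : HasCompactSupport φ) (m : ℕ) {a : ℝ} (ha0 : 0 ≤ a) (ha1 : a ≤ 1) :
    ∃ H : ℝ, 0 < H ∧ ∀ u v, |iteratedDeriv m φ u - iteratedDeriv m φ v| ≤ H * |u - v| ^ a := by
  have hcs : ∀ k, HasCompactSupport (iteratedDeriv k φ) := by
    intro k
    induction k with
    | zero => simpa using hc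
    | succ k ih => rw [iteratedDeriv_succ]; exact ih.deriv
  have hcont : ∀ k : ℕ, Continuous (iteratedDeriv k φ) :=
    fun k => (hφ k).continuous_iteratedDeriv k le_rfl
  obtain ⟨B, hB⟩ := (hcs m).exists_bound_of_continuous (hcont m)
  obtain ⟨B', hB'⟩ := (hcs (m + 1)).exists_bound_of_continuous (hcont (m + 1))
  have hdiff : Differentiable ℝ (iteratedDeriv m φ) :=
    (hφ (m + 1)).differentiable_iteratedDeriv m (by exact_mod_cast Nat.lt_succ_self m)
  have hlip : ∀ u v, |iteratedDeriv m φ u - iteratedDeriv m φ v| ≤ B' * |u - v| := by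
    intro u v
    refine Convex.norm_image_sub_le_of_norm_deriv_le (s := Set.univ) (fun x _ => hdiff x)
      (fun x _ => ?_) convex_univ (Set.mem_univ v) (Set.mem_univ u)
    rw [← iteratedDeriv_succ]
    exact hB' x
  have hB0 : 0 ≤ B := (norm_nonneg _).trans (hB 0)
  have hB'0 : 0 ≤ B' := (norm_nonneg _).trans (hB' 0)
  -- For `|u - v| ≤ 1` the Lipschitz bound `B'` suffices because `a ≤ 1`; beyond that, the sup bound
  -- `2 * B` does because `a ≥ 0`. The extra `1` makes the constant positive.
  refine ⟨2 * B + B' + 1, by positivity, fun u v => ?_⟩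
  have hpow : 0 ≤ |u - v| ^ a := by positivity
  rcases le_total |u - v| 1 with h | h
  · have h1 : |u - v| ≤ |u - v| ^ a := by
      simpa using Real.rpow_le_rpow_of_exponent_ge' (abs_nonneg (u - v)) h ha0 ha1
    calc _ ≤ B' * |u - v| := hlip u v
      _ ≤ B' * |u - v| ^ a := by gcongr
      _ ≤ (2 * B + B' + 1) * |u - v| ^ a := by
        gcongr
        linarith
  · have h1 : 1 ≤ |u - v| ^ a := Real.one_le_rpow h ha0
    have h2 : |iteratedDeriv m φ u - iteratedDeriv m φ v| ≤ 2 * B := by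
      refine (abs_sub _ _).trans ?_
      have := hB u
      have := hB v
      simp only [Real.norm_eq_abs] at *
      linarith
    nlinarith

/-! ### Test functions and anisotropic bumps -/

/-- There is a test function of mean zero supported in the unit interval. -/
theorem exists_mean_zero_bump : ∃ φ : ℝ → ℝ, (∀ m : ℕ, ContDiff ℝ m φ) ∧ HasCompactSupport φ ∧
    (∀ t, |φ t| ≤ 1) ∧ (∀ t, 1 / 2 ≤ |t| → φ t = 0) ∧ φ (1 / 4) = 1 / 4 ∧ ∫ t, φ t = 0 := by
  let ψ : ContDiffBump (0 : ℝ) := ⟨1 / 4, 1 / 2, by norm_num, by norm_num⟩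
  have hz : ∀ t, 1 / 2 ≤ |t| → ψ t = 0 := fun t ht => ψ.zero_of_le_dist (by
    rw [dist_zero_right]; exact ht)
  -- An even bump times `t` is odd, which gives mean zero. At `1 / 4` the bump still equals `1`.
  refine ⟨fun t => t * ψ t, fun m => contDiff_id.mul ψ.contDiff, ψ.hasCompactSupport.mul_left,
    fun t => ?_, fun t ht => by simp [hz t ht], ?_, ?_⟩
  · by_cases ht : 1 / 2 ≤ |t|
    · simp [hz t ht]
    · rw [abs_mul, abs_of_nonneg ψ.nonneg]
      nlinarith [abs_nonneg t, ψ.le_one (x := t), ψ.nonneg (x := t)]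
  · have : ψ (1 / 4) = 1 := ψ.one_of_mem_closedBall (by
      rw [Metric.mem_closedBall, dist_zero_right]
      norm_num [ψ])
    simp only [this, mul_one]
  · have h := integral_neg_eq_self (fun t => t * ψ t) (volume : Measure ℝ)
    simp only [ψ.neg, neg_mul, integral_neg] at h
    linarith

/-- A rescaled translated tensor power of `φ`. -/
noncomputable def tensorBump {d : ℕ} (φ : ℝ → ℝ) (A : ℝ) (c h : Fin d → ℝ) (x : Fin d → ℝ) : ℝ :=
  A * ∏ j, φ ((x j - c j) / h j)

/-- Only the `i`-th factor varies along `e_i`, so directional smoothness reduces to that of a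
rescaled `φ`. -/
theorem tensorBump_line {d : ℕ} (φ : ℝ → ℝ) (A : ℝ) (c h x : Fin d → ℝ) (i : Fin d) (u : ℝ) :
    tensorBump φ A c h (x + u • Pi.single i 1)
      = (A * ∏ j ∈ Finset.univ.erase i, φ ((x j - c j) / h j))
        * φ ((h i)⁻¹ * (u + (x i - c i))) := by
  unfold tensorBump
  rw [← Finset.mul_prod_erase _ _ (Finset.mem_univ i), mul_assoc, mul_comm (∏ j ∈ _, _)]
  congr 2
  · congr 1
    simp
    ring
  · refine Finset.prod_congr rfl fun j hj => ?_
    simp [Finset.ne_of_mem_erase hj]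

theorem hasIterPartials_tensorBump {d : ℕ} {φ : ℝ → ℝ} (hφ : ∀ m : ℕ, ContDiff ℝ m φ) (A : ℝ)
    (c h : Fin d → ℝ) (i : Fin d) (m : ℕ) : HasIterPartials i m (tensorBump φ A c h) := by
  refine hasIterPartials_of_contDiff i m fun x => ?_
  simp only [tensorBump_line]
  exact contDiff_const.mul ((hφ m).comp (contDiff_const.mul (contDiff_id.add contDiff_const)))

/-- The chain rule contributes `(h i) ^ (-⌊s⌋)` and the Hölder increment `(h i) ^ (-(s - ⌊s⌋))`; the
other factors are bounded by `1`. -/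
theorem holderSeminorm_tensorBump_le {d : ℕ} {φ : ℝ → ℝ} (hφ : ∀ m : ℕ, ContDiff ℝ m φ)
    (hφ1 : ∀ t, |φ t| ≤ 1) {A : ℝ} (hA : 0 ≤ A) {c h : Fin d → ℝ} {i : Fin d} (hi : 0 < h i)
    {s H : ℝ} (hH : ∀ u v, |iteratedDeriv ⌊s⌋₊ φ u - iteratedDeriv ⌊s⌋₊ φ v|
      ≤ H * |u - v| ^ (s - ⌊s⌋₊)) :
    holderSeminorm i s (tensorBump φ A c h) ≤ ENNReal.ofReal (A * H * (h i) ^ (-s)) := by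
  have hH0 : 0 ≤ H := by
    have := (abs_nonneg _).trans (hH 1 0)
    simpa using this
  refine iSup₂_le fun x t => ENNReal.ofReal_le_ofReal ?_
  set m := ⌊s⌋₊
  set B := A * ∏ j ∈ Finset.univ.erase i, φ ((x j - c j) / h j) with hB
  have hder : ∀ u : ℝ, iterPartial i m (tensorBump φ A c h) (x + u • Pi.single i 1)
      = B * ((h i)⁻¹ ^ m * iteratedDeriv m φ ((h i)⁻¹ * (u + (x i - c i)))) := by
    intro u
    rw [iterPartial_line]
    simp only [tensorBump_line]
    rw [iteratedDeriv_const_mul_field,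
      iteratedDeriv_comp_add_const (f := fun y => φ ((h i)⁻¹ * y)),
      iteratedDeriv_comp_const_mul (hφ m)]
  have h0 := hder 0
  rw [zero_smul, add_zero] at h0
  have hBA : |B| ≤ A := by
    rw [hB, abs_mul, abs_of_nonneg hA, Finset.abs_prod]
    exact mul_le_of_le_one_right hA (Finset.prod_le_one (fun _ _ => abs_nonneg _) fun _ _ => hφ1 _)
  clear_value B
  rw [hder, h0, ← mul_sub, ← mul_sub, abs_mul, abs_mul, abs_of_nonneg (by positivity :
    0 ≤ (h i)⁻¹ ^ m)]
  have hinc := hH ((h i)⁻¹ * (t + (x i - c i))) ((h i)⁻¹ * (0 + (x i - c i)))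
  have e : (h i)⁻¹ * (t + (x i - c i)) - (h i)⁻¹ * (0 + (x i - c i)) = (h i)⁻¹ * t := by ring
  rw [e, abs_mul, abs_of_pos (inv_pos.mpr hi), Real.mul_rpow (by positivity) (abs_nonneg t)] at hinc
  have hh : (h i)⁻¹ ^ m * (h i)⁻¹ ^ (s - m) = (h i) ^ (-s) := by
    rw [← Real.rpow_natCast, ← Real.rpow_add (inv_pos.mpr hi), Real.rpow_neg hi.le,
      Real.inv_rpow hi.le]
    congr 2
    ring
  -- Only nonnegativity of the denominator is needed, so `t = 0` requires no separate case.
  refine div_le_of_le_mul₀ (by positivity) (by positivity) ?_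
  calc _ ≤ A * ((h i)⁻¹ ^ m * (H * ((h i)⁻¹ ^ (s - m) * |t| ^ (s - m)))) := by gcongr
    _ = A * H * ((h i)⁻¹ ^ m * (h i)⁻¹ ^ (s - m)) * |t| ^ (s - m) := by ring
    _ = _ := by rw [hh]

/-! ### Perturbed densities and their likelihood ratios -/

theorem IsProbDensity.integrable {d : ℕ} {p : (Fin d → ℝ) → ℝ} (hp : IsProbDensity p) :
    Integrable p := by
  refine ⟨hp.measurable.aestronglyMeasurable, ?_⟩
  rw [hasFiniteIntegral_iff_ofReal (Filter.Eventually.of_forall hp.nonneg), hp.lintegral_eq_one]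
  exact ENNReal.one_lt_top

theorem IsProbDensity.isProbabilityMeasure {d : ℕ} {p : (Fin d → ℝ) → ℝ} (hp : IsProbDensity p) :
    IsProbabilityMeasure ((volume : Measure (Fin d → ℝ)).withDensity
      fun x => ENNReal.ofReal (p x)) := by
  refine ⟨?_⟩
  rw [withDensity_apply _ MeasurableSet.univ, Measure.restrict_univ, hp.lintegral_eq_one]

theorem IsProbDensity.integral_withDensity {d : ℕ} {p : (Fin d → ℝ) → ℝ} (hp : IsProbDensity p)
    (f : (Fin d → ℝ) → ℝ) :
    ∫ x, f x ∂((volume : Measure (Fin d → ℝ)).withDensity fun x => ENNReal.ofReal (p x))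
      = ∫ x, p x * f x := by
  rw [integral_withDensity_eq_integral_toReal_smul hp.measurable.ennreal_ofReal
    (Filter.Eventually.of_forall fun x => ENNReal.ofReal_lt_top)]
  simp only [ENNReal.toReal_ofReal (hp.nonneg _), smul_eq_mul]

theorem IsProbDensity.add {d : ℕ} {p g : (Fin d → ℝ) → ℝ} (hp : IsProbDensity p)
    (hg : Measurable g) (hgp : ∀ x, |g x| ≤ p x) (hg0 : ∫ x, g x = 0) : IsProbDensity (p + g) := by
  have hnn : ∀ x, 0 ≤ (p + g) x := fun x => by
    have := neg_abs_le (g x)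
    have := hgp x
    simp only [Pi.add_apply]
    linarith
  have hgi : Integrable g := hp.integrable.mono' hg.aestronglyMeasurable
    (Filter.Eventually.of_forall hgp)
  refine ⟨hp.measurable.add hg, hnn, ?_⟩
  have h1 : ∫ x, p x = 1 := by
    rw [integral_eq_lintegral_of_nonneg_ae (Filter.Eventually.of_forall hp.nonneg)
      hp.measurable.aestronglyMeasurable, hp.lintegral_eq_one, ENNReal.toReal_one]
  rw [← ofReal_integral_eq_lintegral_ofReal (hp.integrable.add hgi)
    (Filter.Eventually.of_forall hnn)]
  simp only [Pi.add_apply]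
  rw [integral_add hp.integrable hgi, h1, hg0, add_zero, ENNReal.ofReal_one]

/-- Disjointly supported small perturbations of a density cannot be detected by a test. -/
theorem half_le_test_error_of_disjoint {d n M : ℕ} (hM : 0 < M) {p : (Fin d → ℝ) → ℝ}
    (hp : IsProbDensity p) (hpos : ∀ x, 0 < p x) {g : Fin M → (Fin d → ℝ) → ℝ}
    (hg : ∀ k, Measurable (g k)) (hgp : ∀ k x, |g k x| ≤ p x) (hmean : ∀ k, ∫ x, g k x = 0)
    (hdisj : ∀ k l, k ≠ l → ∀ x, g k x * g l x = 0) {ρ : ℝ}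
    (hρ : ∀ k, ∫ x, g k x ^ 2 / p x ≤ ρ) (hχ : (1 + ρ) ^ n ≤ M / 4)
    {E : Set (Fin n → Fin d → ℝ)} (hE : MeasurableSet E) :
    2⁻¹ ≤ sampleLaw n p Eᶜ + (M : ℝ≥0∞)⁻¹ * ∑ k, sampleLaw n (p + g k) E := by
  set μ := (volume : Measure (Fin d → ℝ)).withDensity fun x => ENNReal.ofReal (p x) with hμ
  have hμP : IsProbabilityMeasure μ := hp.isProbabilityMeasure
  set P := Measure.pi fun _ : Fin n => μ with hP
  have hlaw : sampleLaw n p = P := rfl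
  -- The relative perturbation: `1 + u k` is the one-sample likelihood ratio of `p + g k` to `p`.
  let u : Fin M → (Fin d → ℝ) → ℝ := fun k x => g k x / p x
  have hu : ∀ k, Measurable (u k) := fun k => (hg k).div hp.measurable
  have hu1 : ∀ k x, |u k x| ≤ 1 := fun k x => by
    simp only [u]
    rw [abs_div, abs_of_pos (hpos x)]
    exact div_le_one_of_le₀ (hgp k x) (hpos x).le
  have hui : ∀ k, Integrable (u k) μ := fun k =>
    Integrable.of_bound (hu k).aestronglyMeasurable 1 (Filter.Eventually.of_forall (hu1 k))
  have huu : ∀ k l, Integrable (fun x => u k x * u l x) μ := fun k l =>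
    Integrable.of_bound ((hu k).mul (hu l)).aestronglyMeasurable 1
      (Filter.Eventually.of_forall fun x => by
        rw [Real.norm_eq_abs, abs_mul]
        exact mul_le_one₀ (hu1 k x) (abs_nonneg _) (hu1 l x))
  have hum : ∀ k, ∫ x, u k x ∂μ = 0 := fun k => by
    rw [hμ, hp.integral_withDensity, ← hmean k]
    refine integral_congr_ae (Filter.Eventually.of_forall fun x => ?_)
    exact mul_div_cancel₀ _ (hpos x).ne'
  have huo : ∀ k l, k ≠ l → ∀ x, u k x * u l x = 0 := fun k l hkl x => by
    simp only [u]
    rw [div_mul_div_comm, hdisj k l hkl x, zero_div]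
  have hus : ∀ k, ∫ x, u k x * u k x ∂μ ≤ ρ := fun k => by
    refine le_of_eq_of_le ?_ (hρ k)
    rw [hμ, hp.integral_withDensity]
    refine integral_congr_ae (Filter.Eventually.of_forall fun x => ?_)
    have := (hpos x).ne'
    simp only [u]
    field_simp
  have hv0 : ∀ k x, 0 ≤ 1 + u k x := fun k x => by
    have := neg_abs_le (u k x)
    have := hu1 k x
    linarith
  have hvi : ∀ k, Integrable (fun x => 1 + u k x) μ := fun k => (integrable_const 1).add (hui k)
  have hvvi : ∀ k l, Integrable (fun x => (1 + u k x) * (1 + u l x)) μ := fun k l => by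
    have : (fun x => (1 + u k x) * (1 + u l x))
        = fun x => (1 + u k x) + u l x + u k x * u l x := by
      funext x; ring
    rw [this]
    exact ((hvi k).add (hui l)).add (huu k l)
  have hv1 : ∀ k, ∫ x, (1 + u k x) ∂μ = 1 := fun k => by
    rw [integral_add (integrable_const 1) (hui k), hum k]
    simp
  have hvv : ∀ k l, ∫ x, (1 + u k x) * (1 + u l x) ∂μ = 1 + ∫ x, u k x * u l x ∂μ :=
    fun k l => by
    have : (fun x => (1 + u k x) * (1 + u l x))
        = fun x => (1 + u k x) + u l x + u k x * u l x := by
      funext x; ring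
    have h2 : Integrable (fun x => (1 + u k x) + u l x) μ := (hvi k).add (hui l)
    rw [this, integral_add h2 (huu k l), integral_add (hvi k) (hui l), hv1, hum, add_zero]
  let F : Fin M → (Fin n → Fin d → ℝ) → ℝ := fun k x => ∏ i, (1 + u k (x i))
  have hF0 : ∀ k x, 0 ≤ F k x := fun k x => Finset.prod_nonneg fun i _ => hv0 k _
  have hF : ∀ k, Integrable (F k) P := fun k =>
    Integrable.fintype_prod (f := fun _ : Fin n => fun x => 1 + u k x) fun _ => hvi k
  have hFF' : ∀ k l, (fun x => F k x * F l x)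
      = fun x => ∏ i, ((1 + u k (x i)) * (1 + u l (x i))) := fun k l => by
    funext x
    simp only [F]
    rw [Finset.prod_mul_distrib]
  have hFF : ∀ k l, Integrable (fun x => F k x * F l x) P := fun k l => by
    rw [hFF']
    exact Integrable.fintype_prod (f := fun _ : Fin n => fun x => (1 + u k x) * (1 + u l x))
      fun _ => hvvi k l
  -- Independence tensorizes the inner products. Disjoint supports give `1` off the diagonal, and
  -- the diagonal is controlled by `ρ`.
  have hFFint : ∀ k l, ∫ x, F k x * F l x ∂P = (1 + ∫ x, u k x * u l x ∂μ) ^ n := fun k l => by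
    rw [hFF', hP, integral_fintype_prod_eq_pow (f := fun x => (1 + u k x) * (1 + u l x)), hvv,
      Fintype.card_fin]
  have key := half_le_error_of_orthogonal P hM hF hFF
    (fun k => by
      simp only [F]
      rw [hP, integral_fintype_prod_eq_pow (f := fun x => 1 + u k x), hv1, one_pow])
    (fun k l hkl => by
      rw [hFFint]
      simp only [huo k l hkl, integral_zero, add_zero, one_pow])
    (fun k => by
      rw [hFFint]
      refine le_trans (pow_le_pow_left₀ ?_ (by linarith [hus k]) n) hχ
      have : 0 ≤ ∫ x, u k x * u k x ∂μ := integral_nonneg fun x => mul_self_nonneg _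
      linarith) hE
  have hlawk : ∀ k, sampleLaw n (p + g k) E = ENNReal.ofReal (∫ x in E, F k x ∂P) := by
    intro k
    have h1 : ((volume : Measure (Fin d → ℝ)).withDensity fun x => ENNReal.ofReal ((p + g k) x))
        = μ.withDensity fun x => ENNReal.ofReal (1 + u k x) := by
      have h3 : Measurable fun x => ENNReal.ofReal (1 + u k x) :=
        (measurable_const.add (hu k)).ennreal_ofReal
      rw [hμ, ← withDensity_mul _ hp.measurable.ennreal_ofReal h3]
      congr 1
      funext x
      rw [Pi.mul_apply, ← ENNReal.ofReal_mul (hpos x).le]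
      congr 1
      have := (hpos x).ne'
      simp only [u, Pi.add_apply]
      field_simp
    have h2 : sampleLaw n (p + g k) = P.withDensity fun x => ENNReal.ofReal (F k x) := by
      unfold sampleLaw
      rw [h1, pi_withDensity_ofReal μ (hvi k) (hv0 k)]
    rw [h2, withDensity_apply _ hE, ofReal_integral_eq_lintegral_ofReal (hF k).integrableOn
      (Filter.Eventually.of_forall (hF0 k))]
  simp only [hlawk, hlaw]
  have hMpos : (0 : ℝ) < M := by exact_mod_cast hM
  rw [← ENNReal.ofReal_sum_of_nonneg fun k _ => integral_nonneg (hF0 k), ← ENNReal.ofReal_natCast M,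
    ← ENNReal.ofReal_inv_of_pos hMpos, ← ENNReal.ofReal_mul (by positivity),
    ← ofReal_measureReal (μ := P) (s := Eᶜ), ← ENNReal.ofReal_add measureReal_nonneg
      (mul_nonneg (by positivity) (Finset.sum_nonneg fun k _ => integral_nonneg (hF0 k)))]
  refine le_trans (le_of_eq ?_) (ENNReal.ofReal_le_ofReal key)
  rw [one_div, ENNReal.ofReal_inv_of_pos (by norm_num)]
  simp

/-- A nonempty open set has positive volume, so a pointwise value of a continuous function bounds
the essential supremum from below. -/
theorem enorm_le_eLpNormEssSup_of_continuous {d : ℕ} {g : (Fin d → ℝ) → ℝ} (hg : Continuous g)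
    (x : Fin d → ℝ) : ‖g x‖ₑ ≤ eLpNormEssSup g volume := by
  by_contra hcon
  have hopen : IsOpen {y | eLpNormEssSup g volume < ‖g y‖ₑ} :=
    isOpen_lt continuous_const hg.enorm
  exact (hopen.measure_pos volume ⟨x, not_le.mp hcon⟩).ne' meas_eLpNormEssSup_lt

/-! ### The Gaussian density and its size on a cube -/

theorem continuous_gaussianOfSup {d : ℕ} (hd : 0 < d) {b : ℝ} (hb : 0 < b) :
    Continuous (gaussianOfSup d b) := by
  rw [funext fun x => gaussianOfSup_eq hd hb x]
  fun_prop

theorem gaussianOfSup_pos {d : ℕ} (hd : 0 < d) {b : ℝ} (hb : 0 < b) (x : Fin d → ℝ) :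
    0 < gaussianOfSup d b x := by
  rw [gaussianOfSup_eq hd hb]
  positivity

theorem gaussianOfSup_le {d : ℕ} (hd : 0 < d) {b : ℝ} (hb : 0 < b) (x : Fin d → ℝ) :
    gaussianOfSup d b x ≤ b := by
  rw [gaussianOfSup_eq hd hb]
  refine mul_le_of_le_one_right hb.le (Real.exp_le_one_iff.mpr ?_)
  have : 0 ≤ Real.pi * b ^ ((2 : ℝ) / d) * ∑ i, x i ^ 2 := by positivity
  linarith

theorem isProbDensity_gaussianOfSup {d : ℕ} (hd : 0 < d) {b : ℝ} (hb : 0 < b) :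
    IsProbDensity (gaussianOfSup d b) := by
  refine ⟨(continuous_gaussianOfSup hd hb).measurable, fun x => (gaussianOfSup_pos hd hb x).le, ?_⟩
  have hv : Real.toNNReal (b ^ (-(2 : ℝ) / d) / (2 * Real.pi)) ≠ 0 := by
    rw [Ne, Real.toNNReal_eq_zero, not_le]
    positivity
  have hint : Integrable (gaussianOfSup d b) :=
    Integrable.fintype_prod (f := fun _ : Fin d => gaussianPDFReal 0 _)
      fun _ => integrable_gaussianPDFReal 0 _
  rw [← ofReal_integral_eq_lintegral_ofReal hint
    (Filter.Eventually.of_forall fun x => (gaussianOfSup_pos hd hb x).le)]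
  unfold gaussianOfSup
  rw [integral_fintype_prod_volume_eq_prod
    (f := fun _ : Fin d => gaussianPDFReal 0 (Real.toNNReal (b ^ (-(2 : ℝ) / d) / (2 * Real.pi))))]
  simp [integral_gaussianPDFReal_eq_one 0 hv]

/-- Since `b ^ (2/d) * r ^ 2 = 1`, the exponent on the cube lies between `-4πd` and `-πd`,
independently of `b`. The lower bound controls the chi-square distance and positivity; the upper one
leaves room below `b` for a bump. -/
theorem gaussianOfSup_bounds {d : ℕ} (hd : 0 < d) {b : ℝ} (hb : 0 < b) {x : Fin d → ℝ}
    (hx : ∀ j, b ^ (-(1 : ℝ) / d) ≤ x j ∧ x j ≤ 2 * b ^ (-(1 : ℝ) / d)) :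
    Real.exp (-(4 * Real.pi * d)) * b ≤ gaussianOfSup d b x ∧ gaussianOfSup d b x ≤ b / 2 := by
  have hd' : (d : ℝ) ≠ 0 := by positivity
  have hd1 : (1 : ℝ) ≤ d := by exact_mod_cast hd
  set r := b ^ (-(1 : ℝ) / d) with hr
  have hr0 : 0 < r := by positivity
  have hscale : b ^ ((2 : ℝ) / d) * r ^ 2 = 1 := by
    rw [hr, ← Real.rpow_natCast, ← Real.rpow_mul hb.le, ← Real.rpow_add hb]
    convert Real.rpow_zero b using 2
    push_cast
    ring
  have hlow : d * r ^ 2 ≤ ∑ j, x j ^ 2 := by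
    have := Finset.sum_le_sum fun j (_ : j ∈ Finset.univ) =>
      pow_le_pow_left₀ hr0.le (hx j).1 2
    simpa using this
  have hup : ∑ j, x j ^ 2 ≤ 4 * (d * r ^ 2) := by
    have := Finset.sum_le_sum fun j (_ : j ∈ Finset.univ) =>
      pow_le_pow_left₀ (hr0.le.trans (hx j).1) (hx j).2 2
    simp only [Finset.sum_const, Finset.card_univ, Fintype.card_fin, nsmul_eq_mul] at this
    linarith
  rw [gaussianOfSup_eq hd hb]
  have hc : 0 ≤ Real.pi * b ^ ((2 : ℝ) / d) := by positivity
  have h1 := mul_le_mul_of_nonneg_left hlow hc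
  have h2 := mul_le_mul_of_nonneg_left hup hc
  have e1 : Real.pi * b ^ ((2 : ℝ) / d) * (d * r ^ 2) = Real.pi * d := by
    rw [show Real.pi * b ^ ((2 : ℝ) / d) * (d * r ^ 2)
      = Real.pi * d * (b ^ ((2 : ℝ) / d) * r ^ 2) by ring, hscale, mul_one]
  have e2 : Real.pi * b ^ ((2 : ℝ) / d) * (4 * (d * r ^ 2)) = 4 * Real.pi * d := by
    linarith
  constructor
  · rw [mul_comm]
    exact mul_le_mul_of_nonneg_left (Real.exp_le_exp.mpr (by linarith)) hb.le
  · have hexp : Real.exp (-1) ≤ 1 / 2 := by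
      rw [Real.exp_neg, one_div]
      exact inv_anti₀ (by norm_num) (by linarith [Real.add_one_le_exp 1])
    have hpd : 1 ≤ Real.pi * d := by nlinarith [Real.pi_gt_three]
    have : Real.exp (-(Real.pi * b ^ ((2 : ℝ) / d) * ∑ i, x i ^ 2)) ≤ 1 / 2 :=
      (Real.exp_le_exp.mpr (by linarith)).trans hexp
    nlinarith

/-! ### Size, support and moments of the bumps -/

section Bump

variable {d : ℕ} {φ : ℝ → ℝ}

theorem continuous_tensorBump (hφ : Continuous φ) (A : ℝ) (c h : Fin d → ℝ) :
    Continuous (tensorBump φ A c h) := by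
  unfold tensorBump
  fun_prop

theorem abs_tensorBump_le (hφ1 : ∀ t, |φ t| ≤ 1) {A : ℝ} (hA : 0 ≤ A) (c h x : Fin d → ℝ) :
    |tensorBump φ A c h x| ≤ A := by
  unfold tensorBump
  rw [abs_mul, abs_of_nonneg hA, Finset.abs_prod]
  exact mul_le_of_le_one_right hA (Finset.prod_le_one (fun _ _ => abs_nonneg _) fun _ _ => hφ1 _)

theorem abs_sub_lt_of_tensorBump_ne_zero (hφ0 : ∀ t, 1 / 2 ≤ |t| → φ t = 0) {A : ℝ}
    {c h x : Fin d → ℝ} (hh : ∀ j, 0 < h j) (hx : tensorBump φ A c h x ≠ 0) (j : Fin d) :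
    |x j - c j| < h j / 2 := by
  by_contra hcon
  refine hx ?_
  unfold tensorBump
  rw [Finset.prod_eq_zero (Finset.mem_univ j), mul_zero]
  refine hφ0 _ ?_
  rw [abs_div, abs_of_pos (hh j), le_div_iff₀ (hh j)]
  linarith [not_lt.mp hcon]

theorem integral_comp_sub_div (f : ℝ → ℝ) (c : ℝ) {h : ℝ} (hh : 0 < h) :
    ∫ t, f ((t - c) / h) = h * ∫ t, f t := by
  rw [integral_sub_right_eq_self (fun t => f (t / h)) c, Measure.integral_comp_div f h,
    abs_of_pos hh, smul_eq_mul]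

theorem integral_tensorBump_eq_zero (hd : 0 < d) (hφ : ∫ t, φ t = 0) (A : ℝ) (c : Fin d → ℝ)
    {h : Fin d → ℝ} (hh : ∀ j, 0 < h j) : ∫ x, tensorBump φ A c h x = 0 := by
  unfold tensorBump
  rw [integral_const_mul, integral_fintype_prod_volume_eq_prod (f := fun j t => φ ((t - c j) / h j)),
    Finset.prod_eq_zero (Finset.mem_univ (⟨0, hd⟩ : Fin d)), mul_zero]
  rw [integral_comp_sub_div φ _ (hh _), hφ, mul_zero]

theorem integrable_tensorBump_sq (hφ : Continuous φ) (hc : HasCompactSupport φ) (A : ℝ)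
    (c : Fin d → ℝ) {h : Fin d → ℝ} (hh : ∀ j, 0 < h j) :
    Integrable fun x => tensorBump φ A c h x ^ 2 := by
  have hint : Integrable fun t => φ t ^ 2 := by
    simp only [pow_two]
    exact (hφ.mul hφ).integrable_of_hasCompactSupport hc.mul_left
  have h1 : ∀ j, Integrable fun t => φ ((t - c j) / h j) ^ 2 := fun j =>
    (hint.comp_div (hh j).ne').comp_sub_right (c j)
  simp only [tensorBump, mul_pow, ← Finset.prod_pow]
  exact (Integrable.fintype_prod (f := fun j t => φ ((t - c j) / h j) ^ 2) h1).const_mul _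

theorem integral_tensorBump_sq_le (hφ1 : ∀ t, |φ t| ≤ 1) (hφ0 : ∀ t, 1 / 2 ≤ |t| → φ t = 0)
    (A : ℝ) (c : Fin d → ℝ) {h : Fin d → ℝ} (hh : ∀ j, 0 < h j) :
    ∫ x, tensorBump φ A c h x ^ 2 ≤ A ^ 2 * ∏ j, h j := by
  have hle : ∫ t, φ t ^ 2 ≤ 1 := by
    have hI : Integrable ((Set.Icc (-(1 / 2) : ℝ) (1 / 2)).indicator fun _ => (1 : ℝ)) :=
      (integrable_indicator_iff measurableSet_Icc).mpr (integrableOn_const (by simp))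
    have := integral_mono_of_nonneg (f := fun t => φ t ^ 2)
      (Filter.Eventually.of_forall fun t => sq_nonneg _) hI
      (Filter.Eventually.of_forall fun t => by
        by_cases ht : t ∈ Set.Icc (-(1 / 2) : ℝ) (1 / 2)
        · simp only [Set.indicator_of_mem ht]
          exact (sq_le_one_iff_abs_le_one _).mpr (hφ1 t)
        · simp only [Set.indicator_of_notMem ht]
          rw [hφ0 t]
          · norm_num
          · by_contra hcon
            exact ht (abs_le.mp (not_le.mp hcon).le))
    refine this.trans ?_
    rw [integral_indicator measurableSet_Icc]
    norm_num
  have hnn : 0 ≤ ∫ t, φ t ^ 2 := integral_nonneg fun t => sq_nonneg _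
  simp only [tensorBump, mul_pow, ← Finset.prod_pow]
  rw [integral_const_mul,
    integral_fintype_prod_volume_eq_prod (f := fun j t => φ ((t - c j) / h j) ^ 2)]
  refine mul_le_mul_of_nonneg_left (Finset.prod_le_prod (fun j _ => ?_) fun j _ => ?_) (sq_nonneg A)
  · exact integral_nonneg fun t => sq_nonneg _
  · rw [integral_comp_sub_div (fun t => φ t ^ 2) _ (hh j)]
    exact mul_le_of_le_one_right (hh j).le hle

end Bump

/-! ### The lower bound for given height and bandwidths -/

/-- Minimax lower bound obtained by perturbing the Gaussian density by bumps of height `A` and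
bandwidths `h`, placed at `M` positions along the axis `j₀`. -/
theorem le_minimaxRisk_of_bumps {d : ℕ} (hd : 0 < d) {β L : Fin d → ℝ} (hL : ∀ j, 0 ≤ L j)
    {b : ℝ} (hb : 0 < b)
    (hgauss : gaussianOfSup d b ∈ anisoClass β (fun j => L j / 2) ⊤)
    {φ : ℝ → ℝ} (hφ : ∀ m : ℕ, ContDiff ℝ m φ) (hc : HasCompactSupport φ)
    (hφ1 : ∀ t, |φ t| ≤ 1) (hφ0 : ∀ t, 1 / 2 ≤ |t| → φ t = 0) (hφ4 : φ (1 / 4) = 1 / 4)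
    (hφm : ∫ t, φ t = 0) {H : Fin d → ℝ}
    (hH : ∀ j u v, |iteratedDeriv ⌊β j⌋₊ φ u - iteratedDeriv ⌊β j⌋₊ φ v|
      ≤ H j * |u - v| ^ (β j - ⌊β j⌋₊))
    {A : ℝ} (hA : 0 < A) (hAb : A ≤ Real.exp (-(4 * Real.pi * d)) * b) {h : Fin d → ℝ}
    (hh : ∀ j, 0 < h j) (hhr : ∀ j, h j ≤ b ^ (-(1 : ℝ) / d)) {n M : ℕ} (hM : 0 < M) (j₀ : Fin d)
    (hMr : M * h j₀ ≤ b ^ (-(1 : ℝ) / d)) (hhold : ∀ j, A * H j * h j ^ (-β j) ≤ L j / 2)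
    (hχ : (1 + A ^ 2 * (∏ j, h j) / (Real.exp (-(4 * Real.pi * d)) * b)) ^ n ≤ M / 4) :
    ENNReal.ofReal (A * (1 / 4) ^ d / 2) * 4⁻¹
      ≤ minimaxRisk n (densityClass β L (ENNReal.ofReal b)) := by
  set r := b ^ (-(1 : ℝ) / d) with hr
  set q := Real.exp (-(4 * Real.pi * d)) * b with hq
  have hq0 : 0 < q := by positivity
  set p := gaussianOfSup d b with hp
  have hpd : IsProbDensity p := isProbDensity_gaussianOfSup hd hb
  have hpos : ∀ x, 0 < p x := gaussianOfSup_pos hd hb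
  have hφc : Continuous φ := (hφ 0).continuous
  -- The `k`-th bump is centred in the `k`-th cell of width `h j₀` on the axis `j₀`, and in the
  -- first cell on every other axis.
  let κ : Fin M → Fin d → ℝ := fun k j => if j = j₀ then (k : ℝ) else 0
  let c : Fin M → Fin d → ℝ := fun k j => r + h j * (κ k j + 1 / 2)
  let g : Fin M → (Fin d → ℝ) → ℝ := fun k => tensorBump φ A (c k) h
  have hκ : ∀ k j, 0 ≤ κ k j ∧ h j * (κ k j + 1) ≤ r := by
    intro k j
    by_cases hj : j = j₀
    · subst hj
      simp only [κ, if_true]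
      refine ⟨Nat.cast_nonneg _, le_trans ?_ hMr⟩
      rw [mul_comm]
      refine mul_le_mul_of_nonneg_right ?_ (hh j).le
      exact_mod_cast k.2
    · simp only [κ, if_neg hj, zero_add, mul_one]
      exact ⟨le_rfl, hhr j⟩
  have hsupp : ∀ k x, g k x ≠ 0 → ∀ j, r ≤ x j ∧ x j ≤ 2 * r := by
    intro k x hx j
    have h1 := abs_lt.mp (abs_sub_lt_of_tensorBump_ne_zero hφ0 hh hx j)
    have h2 := hκ k j
    have h3 := mul_nonneg (hh j).le h2.1
    simp only [c] at h1
    constructor <;> linarith [h1.1, h1.2, h2.2]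
  have hdisj : ∀ k l, k ≠ l → ∀ x, g k x * g l x = 0 := by
    intro k l hkl x
    by_contra hne
    have h1 := abs_lt.mp (abs_sub_lt_of_tensorBump_ne_zero hφ0 hh (left_ne_zero_of_mul hne) j₀)
    have h2 := abs_lt.mp (abs_sub_lt_of_tensorBump_ne_zero hφ0 hh (right_ne_zero_of_mul hne) j₀)
    simp only [c, κ, if_true] at h1 h2
    have h0 := hh j₀
    rcases lt_or_gt_of_ne hkl with hlt | hlt
    · have : ((k : ℕ) : ℝ) + 1 ≤ (l : ℕ) := by exact_mod_cast hlt
      nlinarith [h1.1, h1.2, h2.1, h2.2]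
    · have : ((l : ℕ) : ℝ) + 1 ≤ (k : ℕ) := by exact_mod_cast hlt
      nlinarith [h1.1, h1.2, h2.1, h2.2]
  have hgA : ∀ k x, |g k x| ≤ A := fun k x => abs_tensorBump_le hφ1 hA.le _ _ _
  have hgp : ∀ k x, |g k x| ≤ p x := by
    intro k x
    by_cases hx : g k x = 0
    · rw [hx, abs_zero]; exact (hpos x).le
    · exact (hgA k x).trans (hAb.trans (gaussianOfSup_bounds hd hb (hsupp k x hx)).1)
  have hgc : ∀ k, Continuous (g k) := fun k => continuous_tensorBump hφc _ _ _
  have hmean : ∀ k, ∫ x, g k x = 0 := fun k => integral_tensorBump_eq_zero hd hφm A _ hh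
  have hρ : ∀ k, ∫ x, g k x ^ 2 / p x ≤ A ^ 2 * (∏ j, h j) / q := by
    intro k
    have h1 : ∫ x, g k x ^ 2 / p x ≤ ∫ x, g k x ^ 2 / q := by
      refine integral_mono_of_nonneg
        (Filter.Eventually.of_forall fun x => div_nonneg (sq_nonneg _) (hpos x).le)
        ((integrable_tensorBump_sq hφc hc A (c k) hh).div_const q)
        (Filter.Eventually.of_forall fun x => ?_)
      by_cases hx : g k x = 0
      · simp [hx]
      · exact div_le_div_of_nonneg_left (sq_nonneg _) hq0
          (gaussianOfSup_bounds hd hb (hsupp k x hx)).1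
    refine h1.trans ?_
    rw [integral_div]
    exact div_le_div_of_nonneg_right (integral_tensorBump_sq_le hφ1 hφ0 A (c k) hh) hq0.le
  have hgip : ∀ k i, HasIterPartials i ⌊β i⌋₊ (g k) := fun k i =>
    hasIterPartials_tensorBump hφ A _ h i _
  have hgh : ∀ k i, holderSeminorm i (β i) (g k) ≤ ENNReal.ofReal (L i / 2) := fun k i =>
    (holderSeminorm_tensorBump_le hφ hφ1 hA.le (hh i) (hH i)).trans
      (ENNReal.ofReal_le_ofReal (hhold i))
  have hp_mem : p ∈ densityClass β L (ENNReal.ofReal b) := by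
    refine ⟨hpd, hgauss.1, ?_, fun i => (hgauss.2.2 i).trans (ENNReal.ofReal_le_ofReal ?_)⟩
    · refine eLpNormEssSup_le_of_ae_bound (Filter.Eventually.of_forall fun x => ?_)
      rw [Real.norm_eq_abs, abs_of_pos (hpos x)]
      exact gaussianOfSup_le hd hb x
    · linarith [hL i]
  have hpk_hold : ∀ k i, holderSeminorm i (β i) (p + g k) ≤ ENNReal.ofReal (L i) := by
    intro k i
    refine (holderSeminorm_add_le (hgauss.1 i).1 (hgip k i)).trans ?_
    refine (add_le_add (hgauss.2.2 i) (hgh k i)).trans (le_of_eq ?_)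
    have := hL i
    rw [← ENNReal.ofReal_add (by positivity) (by positivity), add_halves]
  have hpk_mem : ∀ k, p + g k ∈ densityClass β L (ENNReal.ofReal b) := by
    intro k
    have hd2 : IsProbDensity (p + g k) := hpd.add (hgc k).measurable (hgp k) (hmean k)
    refine ⟨hd2, fun i => ⟨(hgauss.1 i).1.add (hgip k i),
      (hpk_hold k i).trans_lt ENNReal.ofReal_lt_top⟩, ?_, hpk_hold k⟩
    refine eLpNormEssSup_le_of_ae_bound (Filter.Eventually.of_forall fun x => ?_)
    rw [Real.norm_eq_abs, abs_of_nonneg (hd2.nonneg x), Pi.add_apply]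
    by_cases hx : g k x = 0
    · rw [hx, add_zero]; exact gaussianOfSup_le hd hb x
    · have h1 := gaussianOfSup_bounds hd hb (hsupp k x hx)
      have h2 := (le_abs_self _).trans (hgA k x)
      have h3 : p x ≤ b / 2 := h1.2
      have h4 : q ≤ p x := h1.1
      linarith
  refine le_minimaxRisk_of_test hM hp_mem hpk_mem (fun k => ?_) fun E hE =>
    half_le_test_error_of_disjoint hM hpd hpos (fun k => (hgc k).measurable) hgp hmean hdisj hρ hχ hE
  rw [← ENNReal.ofReal_add (by positivity) (by positivity), add_halves, add_sub_cancel_left]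
  -- At this point every factor is `φ (1 / 4) = 1 / 4`, so the bump separates the hypotheses by at
  -- least `A * (1 / 4) ^ d`.
  have hval : g k (fun j => c k j + h j * (1 / 4)) = A * (1 / 4) ^ d := by
    have : ∀ j, (c k j + h j * (1 / 4) - c k j) / h j = 1 / 4 := fun j => by
      have := (hh j).ne'
      field_simp
      ring
    simp only [g, tensorBump, this, hφ4, Finset.prod_const, Finset.card_univ, Fintype.card_fin]
  have := enorm_le_eLpNormEssSup_of_continuous (hgc k) (fun j => c k j + h j * (1 / 4))
  rwa [hval, Real.enorm_eq_ofReal (by positivity)] at this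

/-! ### Exponents and the choice of parameters -/

open Filter Topology

theorem effSmoothness_div {d : ℕ} (hd : 0 < d) {β : Fin d → ℝ} (hβ : ∀ j, 0 < β j) :
    effSmoothness β / (2 * effSmoothness β + d) = 1 / (2 + ∑ j, 1 / β j) := by
  have hd' : (0 : ℝ) < d := by exact_mod_cast hd
  have hσ : 0 < ∑ j, 1 / β j :=
    Finset.sum_pos (fun j _ => one_div_pos.mpr (hβ j)) ⟨⟨0, hd⟩, Finset.mem_univ _⟩
  unfold effSmoothness
  set σ := ∑ j, 1 / β j
  field_simp

theorem prod_rpow_effSmoothness {d : ℕ} (hd : 0 < d) {β L : Fin d → ℝ} (hβ : ∀ j, 0 < β j)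
    (hL : ∀ j, 0 ≤ L j) :
    (∏ j, L j ^ (effSmoothness β / β j)) ^ (1 / (2 * effSmoothness β + d))
      = (∏ j, L j ^ (1 / β j)) ^ (1 / (2 + ∑ j, 1 / β j)) := by
  have h : ∏ j, L j ^ (effSmoothness β / β j) = (∏ j, L j ^ (1 / β j)) ^ effSmoothness β := by
    rw [← Real.finsetProd_rpow _ _ fun j _ => Real.rpow_nonneg (hL j) _]
    refine Finset.prod_congr rfl fun j _ => ?_
    rw [← Real.rpow_mul (hL j)]
    congr 1
    ring
  rw [h, ← Real.rpow_mul (Finset.prod_nonneg fun j _ => Real.rpow_nonneg (hL j) _),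
    mul_one_div, effSmoothness_div hd hβ]

/-- Evaluates the volume scale of a bump; together with `A ^ 2` it produces the power `2 + ∑ 1 / β
j`, the inverse of the rate exponent. -/
theorem prod_bandwidth {d : ℕ} (β : Fin d → ℝ) {A : ℝ} (hA : 0 < A) {a L : Fin d → ℝ}
    (ha : ∀ j, 0 < a j) (hL : ∀ j, 0 < L j) :
    ∏ j, (A * a j / L j) ^ (1 / β j)
      = A ^ (∑ j, 1 / β j) * (∏ j, a j ^ (1 / β j)) / ∏ j, L j ^ (1 / β j) := by
  rw [Real.rpow_sum_of_pos hA, ← Finset.prod_mul_distrib, ← Finset.prod_div_distrib]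
  refine Finset.prod_congr rfl fun j _ => ?_
  rw [Real.div_rpow (mul_pos hA (ha j)).le (hL j).le, Real.mul_rpow hA.le (ha j).le]

theorem tendsto_log_div_rpow {s : ℝ} (hs : 0 < s) :
    Tendsto (fun n : ℕ => Real.log n / (n : ℝ) ^ s) atTop (𝓝 0) :=
  ((isLittleO_log_rpow_atTop hs).tendsto_div_nhds_zero).comp tendsto_natCast_atTop_atTop

theorem tendsto_const_mul_rpow {α : Type*} {l : Filter α} {X : α → ℝ} (hX : Tendsto X l (𝓝 0))
    (K : ℝ) {s : ℝ} (hs : 0 < s) : Tendsto (fun n => (K * X n) ^ s) l (𝓝 0) := by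
  have h := (hX.const_mul K).rpow_const (p := s) (Or.inr hs.le)
  simpa [Real.zero_rpow hs.ne'] using h

end AnisoDensity

open AnisoDensity Filter Topology in
theorem mainTheorem7 {d : ℕ} (hd : 0 < d) (β : Fin d → ℝ) (hβ : ∀ j, 0 < β j) :
    ∃ C : ℝ, 0 < C ∧
      ∀ (L : Fin d → ℝ) (b : ℝ), (∀ j, 0 ≤ L j) → 0 < b →
        AnisoDensity.gaussianOfSup d b ∈ AnisoDensity.anisoClass β (fun j => L j / 2) ⊤ →
        ∃ N : ℕ, ∀ n : ℕ, N ≤ n →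
          ENNReal.ofReal
            (C * b ^ (AnisoDensity.effSmoothness β / (2 * AnisoDensity.effSmoothness β + d))
              * (∏ j, L j ^ (AnisoDensity.effSmoothness β / β j))
                  ^ (1 / (2 * AnisoDensity.effSmoothness β + d))
              * (Real.log n / n)
                  ^ (AnisoDensity.effSmoothness β / (2 * AnisoDensity.effSmoothness β + d)))
            ≤ AnisoDensity.minimaxRisk n
                (AnisoDensity.densityClass β L (ENNReal.ofReal b)) := by
  obtain ⟨φ, hφ, hc, hφ1, hφ0, hφ4, hφm⟩ := exists_mean_zero_bump
  choose H hH0 hH using fun j => exists_iteratedDeriv_holder hφ hc ⌊β j⌋₊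
    (a := β j - ⌊β j⌋₊) (sub_nonneg.mpr (Nat.floor_le (hβ j).le))
    (by linarith [Nat.lt_floor_add_one (β j)])
  let j₀ : Fin d := ⟨0, hd⟩
  rw [effSmoothness_div hd hβ]
  have hσ : 0 < ∑ j, 1 / β j :=
    Finset.sum_pos (fun j _ => one_div_pos.mpr (hβ j)) ⟨j₀, Finset.mem_univ _⟩
  set γ := 1 / (2 + ∑ j, 1 / β j) with hγ
  have hγ0 : 0 < γ := by positivity
  set q := Real.exp (-(4 * Real.pi * d)) with hq
  have hq0 : 0 < q := Real.exp_pos _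
  set θ := γ * (1 / β j₀) with hθ
  have hθ0 : 0 < θ := mul_pos hγ0 (one_div_pos.mpr (hβ j₀))
  set G := ∏ j, (2 * H j) ^ (1 / β j) with hG
  have hH2 : ∀ j, 0 < 2 * H j := fun j => mul_pos two_pos (hH0 j)
  have hG0 : 0 < G := Finset.prod_pos fun j _ => Real.rpow_pos_of_pos (hH2 j) _
  -- Chosen so that the chi-square term below is exactly `θ / 2 * log n / n`. It depends only on `β`
  -- and `d`, since `φ` is fixed beforehand.
  set κ := θ * q / (2 * G) with hκ
  have hκ0 : 0 < κ := by positivity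
  refine ⟨κ ^ γ * (1 / 4) ^ d / 8, by positivity, fun L b hL hb hgauss => ?_⟩
  rw [prod_rpow_effSmoothness hd hβ hL, ← hγ]
  -- If some `L j` vanishes, so does the claimed lower bound.
  by_cases hLpos : ∀ j, 0 < L j
  swap
  · obtain ⟨j, hj⟩ := not_forall.mp hLpos
    have hj0 : L j = 0 := le_antisymm (not_lt.mp hj) (hL j)
    refine ⟨0, fun n _ => ?_⟩
    rw [Finset.prod_eq_zero (Finset.mem_univ j), Real.zero_rpow hγ0.ne', mul_zero, zero_mul,
      ENNReal.ofReal_zero]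
    · exact zero_le
    · rw [hj0, Real.zero_rpow (one_div_pos.mpr (hβ j)).ne']
  set Λ := ∏ j, L j ^ (1 / β j) with hΛ
  have hΛ0 : 0 < Λ := Finset.prod_pos fun j _ => Real.rpow_pos_of_pos (hLpos j) _
  let X : ℕ → ℝ := fun n => Real.log n / n
  -- Here `A n ^ (2 + ∑ 1 / β j) = κ * b * Λ * X n`, and `h` solves `A * H j * h j ^ (-β j) = L j /
  -- 2`.
  let A : ℕ → ℝ := fun n => (κ * b * Λ * X n) ^ γ
  let h : ℕ → Fin d → ℝ := fun n j => (A n * (2 * H j) / L j) ^ (1 / β j)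
  set r := b ^ (-(1 : ℝ) / d) with hr
  have hr0 : 0 < r := by positivity
  have hX : Tendsto X atTop (𝓝 0) := by simpa using tendsto_log_div_rpow one_pos
  have hA : Tendsto A atTop (𝓝 0) := tendsto_const_mul_rpow hX _ hγ0
  have hh : ∀ j, Tendsto (fun n => h n j) atTop (𝓝 0) := fun j => by
    have := tendsto_const_mul_rpow hA (2 * H j / L j) (one_div_pos.mpr (hβ j))
    refine this.congr fun n => ?_
    simp only [h]
    congr 1
    ring
  -- As `h n j₀` is a constant times `(log n / n) ^ θ`, the product with `n ^ (θ / 2)` is a constant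
  -- times `(log n / n ^ (1/2)) ^ θ`, which tends to zero. The factor `5` instead of `4` absorbs the
  -- floor in the number of bumps.
  have hgrid : ∀ᶠ n in atTop, h n j₀ * (5 * (n : ℝ) ^ (θ / 2)) ≤ r := by
    set K := ((κ * b * Λ) ^ γ * (2 * H j₀ / L j₀)) ^ (1 / β j₀)
    have hY := (tendsto_const_mul_rpow (tendsto_log_div_rpow (half_pos one_pos)) 1 hθ0).const_mul
      (5 * K)
    rw [mul_zero] at hY
    filter_upwards [hY.eventually_le_const hr0, eventually_ge_atTop 2] with n hn hn2
    refine le_of_eq_of_le ?_ hn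
    have hn0 : (0 : ℝ) < n := by positivity
    have hX0 : 0 ≤ X n := div_nonneg (Real.log_natCast_nonneg n) hn0.le
    have hLH : 0 < 2 * H j₀ / L j₀ := div_pos (hH2 _) (hLpos _)
    have e1 : h n j₀ = K * X n ^ θ := by
      simp only [h, A, K]
      rw [Real.mul_rpow (by positivity) hX0, mul_div_assoc,
        mul_right_comm, Real.mul_rpow (by positivity) (by positivity), ← Real.rpow_mul hX0]
    have e2 : X n ^ θ * (n : ℝ) ^ (θ / 2) = (1 * (Real.log n / (n : ℝ) ^ ((1 : ℝ) / 2))) ^ θ := by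
      rw [show θ / 2 = 1 / 2 * θ by ring, Real.rpow_mul hn0.le,
        ← Real.mul_rpow hX0 (by positivity), one_mul]
      congr 1
      simp only [X]
      have : (n : ℝ) = (n : ℝ) ^ ((1 : ℝ) / 2) * (n : ℝ) ^ ((1 : ℝ) / 2) := by
        rw [← Real.rpow_add hn0]; norm_num
      have hs : (n : ℝ) ^ ((1 : ℝ) / 2) ≠ 0 := by positivity
      rw [div_mul_eq_mul_div, div_eq_div_iff hn0.ne' hs, mul_assoc, ← this]
    rw [e1, ← e2]
    ring
  suffices hev : ∀ᶠ n : ℕ in atTop, ENNReal.ofReal (κ ^ γ * (1 / 4) ^ d / 8 * b ^ γ * Λ ^ γ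
      * (Real.log n / n) ^ γ) ≤ minimaxRisk n (densityClass β L (ENNReal.ofReal b)) from
    eventually_atTop.mp hev
  filter_upwards [hgrid, hA.eventually_le_const (mul_pos hq0 hb),
    eventually_all.mpr fun j => (hh j).eventually_le_const hr0, eventually_ge_atTop 2]
    with n hng hnA hnh hn2
  have hn0 : (0 : ℝ) < n := by positivity
  have hn1 : (1 : ℝ) < n := by exact_mod_cast hn2
  have hX0 : 0 < X n := div_pos (Real.log_pos hn1) hn0
  have hA0 : 0 < A n := by positivity
  have hh0 : ∀ j, 0 < h n j := fun j =>
    Real.rpow_pos_of_pos (div_pos (mul_pos hA0 (hH2 j)) (hLpos j)) _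
  have hpow1 : 1 ≤ (n : ℝ) ^ (θ / 2) := Real.one_le_rpow hn1.le (half_pos hθ0).le
  have hMbig : 4 * (n : ℝ) ^ (θ / 2) ≤ (⌊r / h n j₀⌋₊ : ℝ) := by
    have h1 : 5 * (n : ℝ) ^ (θ / 2) ≤ r / h n j₀ := by
      rw [le_div_iff₀ (hh0 j₀), mul_comm]
      exact hng
    linarith [Nat.lt_floor_add_one (r / h n j₀)]
  have hρ : A n ^ 2 * (∏ j, h n j) / (q * b) = θ / 2 * X n := by
    have e1 : A n ^ 2 * A n ^ (∑ j, 1 / β j) = κ * b * Λ * X n := by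
      rw [← Real.rpow_natCast, ← Real.rpow_add hA0, ← Real.rpow_mul (by positivity), hγ]
      push_cast
      rw [one_div_mul_cancel (by positivity), Real.rpow_one]
    simp only [h]
    rw [prod_bandwidth β hA0 hH2 hLpos, ← hG, ← hΛ,
      show A n ^ 2 * (A n ^ (∑ j, 1 / β j) * G / Λ)
        = A n ^ 2 * A n ^ (∑ j, 1 / β j) * (G / Λ) by ring, e1, hκ]
    field_simp
  have hfin := le_minimaxRisk_of_bumps hd hL hb hgauss hφ hc hφ1 hφ0 hφ4 hφm hH hA0 hnA hh0 hnh
    (n := n) (M := ⌊r / h n j₀⌋₊) (by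
      have : (0 : ℝ) < (⌊r / h n j₀⌋₊ : ℝ) := by linarith
      exact_mod_cast this) j₀
    ((le_div_iff₀ (hh0 j₀)).mp (Nat.floor_le (by have := hh0 j₀; positivity)))
    (fun j => by
      have e : h n j ^ (-β j) = (A n * (2 * H j) / L j)⁻¹ := by
        simp only [h]
        have hb' := (hβ j).ne'
        rw [← Real.rpow_mul (div_pos (mul_pos hA0 (hH2 j)) (hLpos j)).le, ← Real.rpow_neg_one]
        congr 1
        field_simp
      rw [e]
      have h1 := (hH0 j).ne'
      have h2 := (hLpos j).ne'
      refine le_of_eq ?_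
      field_simp)
    (by
      rw [hρ]
      -- By `1 + x ≤ exp x`, the `n`-sample second moment is at most `n ^ (θ / 2)`, which `hMbig`
      -- bounds by a quarter of the number of bumps.
      have h1 : (1 + θ / 2 * X n) ^ n ≤ (n : ℝ) ^ (θ / 2) := by
        calc (1 + θ / 2 * X n) ^ n ≤ Real.exp (θ / 2 * X n) ^ n :=
              pow_le_pow_left₀ (by positivity) (by linarith [Real.add_one_le_exp (θ / 2 * X n)]) n
          _ = (n : ℝ) ^ (θ / 2) := by
              rw [← Real.exp_nat_mul, Real.rpow_def_of_pos hn0]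
              congr 1
              simp only [X]
              field_simp
      linarith)
  refine le_of_eq_of_le ?_ hfin
  have h4 : (4 : ℝ≥0∞)⁻¹ = ENNReal.ofReal (1 / 4) := by
    rw [one_div, ENNReal.ofReal_inv_of_pos (by norm_num)]
    simp
  rw [h4, ← ENNReal.ofReal_mul (by positivity)]
  congr 1
  simp only [A]
  rw [Real.mul_rpow (by positivity) hX0.le, Real.mul_rpow (by positivity) hΛ0.le,
    Real.mul_rpow hκ0.le hb.le]
  simp only [X]
  ring
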